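/- Let $k\ge 1$ and $n\ge 2$ be integers, $\Omega>0$ and $\sigma>0$. Let $\mu=\sum_{j=1}^n a_j\delta_{\mathbf y_j}$ with amplitudes $a_j\in\mathbb C\setminus\{0\}$ and points $\mathbf y_j\in\mathbb R^k$ satisfying $\|\mathbf y_j\|_2\le\frac{(n-1)\pi}{2\Omega}$ for all $j$, and put $m_{\min}=\min_{1\le j\le n}|a_j|$. Let the measurement be $$\mathbf Y(\boldsymbol\omega)=\sum_{j=1}^n a_j e^{i\mathbf y_j\cdot\boldsymbol\omega}+\mathbf W(\boldsymbol\omega),\qquad |\mathbf W(\boldsymbol\omega)|<\sigma,\qquad \boldsymbol\omega\in\mathbb R^k,\ \|\boldsymbol\omega\|_2\le\Omega .$$ For $m\ge0$, $\hat a_1,\dots,\hat a_m\in\mathbb C$ and $\hat{\mathbf y}_1,\dots,\hat{\mathbf y}_m\in\mathbb R^k$ (with no restriction on the location of the $\hat{\mathbf y}_j$), the discrete measure $\sum_{j=1}^m\hat a_j\delta_{\hat{\mathbf y}_j}$ is called $\sigma$-admissible for $\mathbf Y$ if $\big|\sum_{j=1}^m\hat a_je^{i\hat{\mathbf y}_j\cdot\boldsymbol\omega}-\mathbf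 Y(\boldsymbol\omega)\big|<\sigma$ for all $\boldsymbol\omega\in\mathbb R^k$ with $\|\boldsymbol\omega\|_2\le\Omega$. Let $s$ be the dimension of the linear span of $\{\mathbf y_1,\dots,\mathbf y_n\}$, and let $\xi(0)=0$ and $\xi(l)=\sum_{j=1}^{l}\frac1j$ for $l\ge1$. If $$\min_{p\ne j}\|\mathbf y_p-\mathbf y_j\|_2\ \ge\ \frac{4.4\,\pi e\,(\pi/2)^{s-1}\,\big(n(n-1)/\pi\big)^{\xi(s-1)}}{\Omega}\Big(\frac{\sigma}{m_{\min}}\Big)^{\frac1{2n-2}},$$ then there is no $\sigma$-admissible measure for $\mathbf Y$ with fewer than $n$ supports, i.e. none of the form above with $m<n$. -/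

import Mathlib

noncomputable section

/-- The Fourier transform `ω ↦ ∑ j, a j * exp (i (y j ⬝ ω))` of the discrete measure
`∑ j, a j • δ_{y j}` on `ℝ^k`. -/
def discreteFourier {k n : ℕ} (a : Fin n → ℂ) (y : Fin n → EuclideanSpace ℝ (Fin k))
    (ω : EuclideanSpace ℝ (Fin k)) : ℂ :=
  ∑ j, a j * Complex.exp (Complex.I * ((inner ℝ (y j) ω : ℝ) : ℂ))

/-- `∑ j, a j • δ_{y j}` is a `σ`-admissible discrete measure of the measurement `Y`, which is
available at the frequencies `‖ω‖ ≤ Ω`. -/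
def IsSigmaAdmissible {k m : ℕ} (Ω σ : ℝ) (Y : EuclideanSpace ℝ (Fin k) → ℂ)
    (a : Fin m → ℂ) (y : Fin m → EuclideanSpace ℝ (Fin k)) : Prop :=
  ∀ ω : EuclideanSpace ℝ (Fin k), ‖ω‖ ≤ Ω → ‖discreteFourier a y ω - Y ω‖ < σ

/-- The minimal amplitude `min_j |a j|` (an attained minimum as soon as `n ≥ 1`). -/
def minAmplitude {n : ℕ} (a : Fin n → ℂ) : ℝ := ⨅ j, ‖a j‖

/-- `ξ(k) = ∑_{j=1}^k 1/j`, with `ξ(0) = 0`. -/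
def xiSum (k : ℕ) : ℝ := ∑ j ∈ Finset.Icc 1 k, 1 / (j : ℝ)

/-- The dimension of the smallest linear subspace containing all the points `y j`. -/
def spanDim {k n : ℕ} (y : Fin n → EuclideanSpace ℝ (Fin k)) : ℕ :=
  Module.finrank ℝ (Submodule.span ℝ (Set.range y))

end

/-! Restricting to a line of frequencies `x • u` projects the problem to dimension one. A unit
vector `u` exists along which every difference `y p - y j` keeps at least the fraction `1 / F` of
its length, `F` being the dimensional factor of the hypothesis; so only the one-dimensional case
`not_forall_norm_fourier_sub_le` remains. There, put `N = n - 1`. The `2N + 1` equispaced samples of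
the difference of the two transforms are moments of size at most `2σ` at nodes on the unit circle.
Let `P` be monic of degree `N`, vanishing at the competing nodes. Testing the moments against `P`
times the product over all true nodes but one isolates one amplitude and bounds `P` at that node.
Since Lagrange interpolation recovers the leading coefficient 1 of `P` from these values, they
cannot all be small. -/

/-! ### Moment functionals and Lagrange interpolation -/

open Polynomial in
theorem norm_map_prod_X_sub_C_le (L : ℂ[X] →ₗ[ℂ] ℂ) {M : ℝ} (S : Multiset ℂ)
    (hS : ∀ w ∈ S, ‖w‖ ≤ 1) (r : ℕ) (hL : ∀ l ≤ S.card + r, ‖L (X ^ l)‖ ≤ M) :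
    ‖L (X ^ r * (S.map fun w => X - C w).prod)‖ ≤ 2 ^ S.card * M := by
  induction S using Multiset.induction_on generalizing r with
  | empty => simpa using hL r (by simp)
  | cons w S ih =>
    have hS' : ∀ v ∈ S, ‖v‖ ≤ 1 := fun v hv => hS v (Multiset.mem_cons_of_mem hv)
    have hw := hS w (Multiset.mem_cons_self w S)
    rw [Multiset.card_cons] at hL
    have h1 := ih hS' (r + 1) fun l hl => hL l (by omega)
    have h0 := ih hS' r fun l hl => hL l (by omega)
    set P := (S.map fun w => X - C w).prod
    have hM : 0 ≤ (2 : ℝ) ^ S.card * M := (norm_nonneg _).trans h0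
    -- Each factor `X - C w` with `‖w‖ ≤ 1` at most doubles the bound.
    have key : X ^ r * ((w ::ₘ S).map fun w => X - C w).prod
        = X ^ (r + 1) * P - w • (X ^ r * P) := by
      rw [Multiset.map_cons, Multiset.prod_cons, smul_eq_C_mul]
      ring
    rw [key, map_sub, map_smul, smul_eq_mul, Multiset.card_cons]
    calc _ ≤ ‖L (X ^ (r + 1) * P)‖ + ‖w‖ * ‖L (X ^ r * P)‖ := by
          rw [← norm_mul]; exact norm_sub_le _ _
      _ ≤ 2 ^ S.card * M + 1 * (2 ^ S.card * M) := by gcongr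
      _ = _ := by ring

open Polynomial in
theorem le_sum_inv_sq_of_norm_moments_le {N m : ℕ} (hm : m ≤ N) {z : Fin (N + 1) → ℂ}
    (hz : Function.Injective z) (hz1 : ∀ j, ‖z j‖ ≤ 1) {w : Fin m → ℂ} (hw : ∀ j, ‖w j‖ ≤ 1)
    {b : Fin (N + 1) → ℂ} {c : Fin m → ℂ} {A M : ℝ} (hA : ∀ j, A ≤ ‖b j‖)
    (hM : ∀ l ≤ 2 * N, ‖∑ j, b j * z j ^ l - ∑ j, c j * w j ^ l‖ ≤ M) :
    A ≤ 4 ^ N * M * ∑ j, ((∏ p ∈ Finset.univ.erase j, ‖z j - z p‖) ^ 2)⁻¹ := by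
  let L : ℂ[X] →ₗ[ℂ] ℂ := ∑ j, b j • leval (z j) - ∑ j, c j • leval (w j)
  have hLv : ∀ P, L P = ∑ j, b j * P.eval (z j) - ∑ j, c j * P.eval (w j) := fun P => by
    simp [L, leval_apply]
  -- Zeros pad the roots so that `P` has degree exactly `N`, as the Lagrange formula needs.
  let T : Multiset ℂ := Finset.univ.val.map w + Multiset.replicate (N - m) 0
  have hT1 : ∀ v ∈ T, ‖v‖ ≤ 1 := by
    intro v hv
    rcases Multiset.mem_add.1 hv with h | h
    · obtain ⟨i, -, rfl⟩ := Multiset.mem_map.1 h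
      exact hw i
    · rw [Multiset.eq_of_mem_replicate h]; simp
  have hTc : T.card = N := by simp [T]; omega
  let P : ℂ[X] := (T.map fun v => X - C v).prod
  have hPw : ∀ i, P.eval (w i) = 0 := fun i => by
    have : w i ∈ T := Multiset.mem_add.2 (.inl (Multiset.mem_map_of_mem _ (by simp)))
    exact dvd_iff_isRoot.1 (Multiset.dvd_prod (Multiset.mem_map_of_mem (fun v => X - C v) this))
  have hPm : P.Monic := monic_multiset_prod_of_monic _ _ fun v _ => monic_X_sub_C v
  have hPd : P.natDegree = N := by
    rw [natDegree_multiset_prod_X_sub_C_eq_card, hTc]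
  have hPdeg : P.degree = N := by rw [degree_eq_natDegree hPm.ne_zero, hPd]
  have hlag := Lagrange.leadingCoeff_eq_sum (s := Finset.univ) (v := z) hz.injOn (P := P)
    (by rw [hPdeg]; simp)
  rw [hPm.leadingCoeff] at hlag
  have hone : ∀ j, A * ‖P.eval (z j)‖ * ∏ p ∈ Finset.univ.erase j, ‖z j - z p‖ ≤ 4 ^ N * M := by
    intro j
    let U : Multiset ℂ := (Finset.univ.erase j).val.map z
    have hUc : U.card = N := by simp [U]
    have h := norm_map_prod_X_sub_C_le L (M := M) (U + T) (by
      intro v hv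
      rcases Multiset.mem_add.1 hv with h | h
      · obtain ⟨i, -, rfl⟩ := Multiset.mem_map.1 h
        exact hz1 i
      · exact hT1 v h) 0 (by
      intro l hl
      rw [Multiset.card_add, hUc, hTc] at hl
      rw [hLv]
      simpa using hM l (by omega))
    have hQ : X ^ 0 * ((U + T).map fun v => X - C v).prod
        = (∏ p ∈ Finset.univ.erase j, (X - C (z p))) * P := by
      simp [U, P, Finset.prod]
    rw [hQ, hLv, Multiset.card_add, hUc, hTc, Finset.sum_eq_single j, Finset.sum_eq_zero, sub_zero,
      norm_mul, eval_mul, norm_mul, eval_prod, norm_prod] at h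
    · simp only [eval_sub, eval_X, eval_C] at h
      calc _ ≤ ‖b j‖ * ‖P.eval (z j)‖ * ∏ p ∈ Finset.univ.erase j, ‖z j - z p‖ := by
            gcongr; exact hA j
        _ = ‖b j‖ * ((∏ p ∈ Finset.univ.erase j, ‖z j - z p‖) * ‖P.eval (z j)‖) := by ring
        _ ≤ _ := h
        _ = 4 ^ N * M := by rw [← two_mul, pow_mul]; norm_num
    · intro i _
      simp [hPw]
    · intro i _ hi
      rw [eval_mul, eval_prod, Finset.prod_eq_zero (i := i)] <;> simp [hi]
    · simp
  rcases le_total A 0 with hA0 | hA0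
  · refine hA0.trans ?_
    have : 0 ≤ M := (norm_nonneg _).trans (hM 0 (by simp))
    positivity
  have hD : ∀ j, 0 < ∏ p ∈ Finset.univ.erase j, ‖z j - z p‖ := fun j =>
    Finset.prod_pos fun p hp => norm_pos_iff.2 (sub_ne_zero.2 (hz.ne (Finset.ne_of_mem_erase hp).symm))
  calc A = A * ‖∑ j, P.eval (z j) / ∏ p ∈ Finset.univ.erase j, (z j - z p)‖ := by
        rw [← hlag]; simp
    _ ≤ A * ∑ j, ‖P.eval (z j)‖ / ∏ p ∈ Finset.univ.erase j, ‖z j - z p‖ := by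
        gcongr
        refine (norm_sum_le _ _).trans_eq (Finset.sum_congr rfl fun j _ => ?_)
        rw [norm_div, norm_prod]
    _ ≤ _ := by
        rw [Finset.mul_sum, Finset.mul_sum]
        refine Finset.sum_le_sum fun j _ => ?_
        have := hD j
        rw [← div_eq_mul_inv, le_div_iff₀ (by positivity)]
        refine le_trans (le_of_eq ?_) (hone j)
        field_simp

/-! ### Separated nodes -/

theorem prod_univ_erase_abs_sub {N : ℕ} (j : Fin (N + 1)) :
    ∏ p ∈ Finset.univ.erase j, |((j : ℕ) : ℝ) - (p : ℕ)|
      = (Nat.factorial j : ℝ) * (Nat.factorial (N - j) : ℝ) := by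
  have hj : (j : ℕ) ≤ N := Nat.lt_succ_iff.1 j.2
  have h1 : ∏ p ∈ Finset.univ.erase j, |((j : ℕ) : ℝ) - (p : ℕ)|
      = ∏ p ∈ (Finset.range (N + 1)).erase j, |((j : ℕ) : ℝ) - (p : ℕ)| := by
    refine Finset.prod_bij (fun p _ => (p : ℕ)) ?_ ?_ ?_ ?_
    · intro p hp
      have := Finset.ne_of_mem_erase hp
      simp [Fin.ext_iff] at this ⊢
      omega
    · intro p _ q _ h
      exact Fin.ext h
    · intro p hp
      simp at hp
      exact ⟨⟨p, by omega⟩, by simp [Fin.ext_iff, hp.1], rfl⟩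
    · intros; rfl
  have h2 : (Finset.range (N + 1)).erase j
      = Finset.range j ∪ Finset.Ico ((j : ℕ) + 1) (N + 1) := by
    ext p; simp; omega
  rw [h1, h2, Finset.prod_union, Finset.prod_Ico_eq_prod_range, ← Finset.prod_range_reflect]
  · rw [← Finset.prod_range_add_one_eq_factorial, ← Finset.prod_range_add_one_eq_factorial]
    push_cast
    congr 1
    · refine Finset.prod_congr rfl fun p hp => ?_
      have := Finset.mem_range.1 hp
      rw [Nat.sub_sub, Nat.cast_sub (by omega), abs_of_nonneg] <;> push_cast <;> linarith
    · refine Finset.prod_congr rfl fun p hp => ?_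
      rw [abs_of_nonpos] <;> linarith
  · rw [Finset.disjoint_left]
    intro p; simp; omega

/-- After sorting, the products dominate those of the grid of step `δ`, whose inverses are binomial
coefficients over `N! δ ^ N`; the binomials sum to `2 ^ N`. -/
theorem sum_inv_sq_prod_abs_sub_le {N : ℕ} {t : Fin (N + 1) → ℝ} {δ : ℝ} (hδ : 0 < δ)
    (ht : ∀ p j, p ≠ j → δ ≤ |t p - t j|) :
    ∑ j, ((∏ p ∈ Finset.univ.erase j, |t j - t p|) ^ 2)⁻¹
      ≤ 4 ^ N / ((Nat.factorial N : ℝ) * δ ^ N) ^ 2 := by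
  wlog hmono : Monotone t generalizing t
  · have h := this (t := t ∘ Tuple.sort t)
      (fun p j hpj => ht _ _ ((Tuple.sort t).injective.ne hpj)) (Tuple.monotone_sort t)
    refine le_trans (le_of_eq ?_) h
    rw [← Equiv.sum_comp (Tuple.sort t)]
    refine Finset.sum_congr rfl fun j _ => ?_
    congr 2
    symm
    refine Finset.prod_equiv (Tuple.sort t) (by simp) fun p _ => rfl
  have hg : Monotone fun i : Fin (N + 1) => t i - (i : ℕ) * δ := by
    refine Fin.monotone_iff_le_succ.2 fun i => ?_
    have h := ht i.succ i.castSucc Fin.castSucc_lt_succ.ne'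
    rw [abs_of_nonneg (sub_nonneg.2 (hmono Fin.castSucc_lt_succ.le))] at h
    simp only [Fin.val_castSucc, Fin.val_succ]
    push_cast
    linarith
  have hdist : ∀ j p : Fin (N + 1), |((j : ℕ) : ℝ) - (p : ℕ)| * δ ≤ |t j - t p| := by
    intro j p
    rcases le_total p j with h | h
    · have h1 := hg h
      have h2 : ((p : ℕ) : ℝ) ≤ (j : ℕ) := Nat.cast_le.2 h
      simp only at h1
      rw [abs_of_nonneg (by linarith)]
      exact le_trans (by linarith) (le_abs_self _)
    · have h1 := hg h
      have h2 : ((j : ℕ) : ℝ) ≤ (p : ℕ) := Nat.cast_le.2 h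
      simp only at h1
      rw [abs_of_nonpos (by linarith)]
      exact le_trans (by linarith) (neg_le_abs _)
  have hprod : ∀ j : Fin (N + 1), ((Nat.factorial j : ℝ) * (Nat.factorial (N - j) : ℝ)) * δ ^ N
      ≤ ∏ p ∈ Finset.univ.erase j, |t j - t p| := by
    intro j
    rw [← prod_univ_erase_abs_sub]
    calc _ = ∏ p ∈ Finset.univ.erase j, (|((j : ℕ) : ℝ) - (p : ℕ)| * δ) := by
          rw [Finset.prod_mul_distrib, Finset.prod_const]; simp
      _ ≤ _ := Finset.prod_le_prod (fun _ _ => by positivity) fun p _ => hdist j p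
  calc _ ≤ ∑ j : Fin (N + 1), ((N.choose j : ℝ) / ((Nat.factorial N : ℝ) * δ ^ N)) ^ 2 := by
        refine Finset.sum_le_sum fun j _ => ?_
        have hj : (j : ℕ) ≤ N := Nat.lt_succ_iff.1 j.2
        have h := hprod j
        have hc : (N.choose j : ℝ) * (Nat.factorial j : ℝ) * (Nat.factorial (N - j) : ℝ)
            = (Nat.factorial N : ℝ) := by exact_mod_cast Nat.choose_mul_factorial_mul_factorial hj
        have h1 : (0 : ℝ) < N.choose j := by exact_mod_cast Nat.choose_pos hj
        rw [← inv_pow]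
        gcongr
        rw [← hc]
        calc _ ≤ (((Nat.factorial j : ℝ) * (Nat.factorial (N - j) : ℝ)) * δ ^ N)⁻¹ := by gcongr
          _ = _ := by field_simp
    _ ≤ (∑ j : Fin (N + 1), (N.choose j : ℝ) / ((Nat.factorial N : ℝ) * δ ^ N)) ^ 2 :=
        Finset.sum_sq_le_sq_sum_of_nonneg fun j _ => by positivity
    _ = _ := by
        rw [← Finset.sum_div, Fin.sum_univ_eq_sum_range (fun j => (N.choose j : ℝ)),
          ← Nat.cast_sum, Nat.sum_range_choose, div_pow, Nat.cast_pow, ← pow_mul, mul_comm N 2,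
          pow_mul]
        norm_num

theorem two_div_pi_mul_abs_sub_le_norm_exp_sub_exp {x y : ℝ} (h : |x - y| ≤ Real.pi) :
    2 / Real.pi * |x - y| ≤ ‖Complex.exp (Complex.I * x) - Complex.exp (Complex.I * y)‖ := by
  have e : Complex.exp (Complex.I * x) - Complex.exp (Complex.I * y)
      = Complex.exp (Complex.I * y) * (Complex.exp (Complex.I * ((x - y : ℝ) : ℂ)) - 1) := by
    rw [mul_sub, ← Complex.exp_add]
    push_cast
    ring_nf
  rw [e, norm_mul, mul_comm Complex.I (y : ℂ), Complex.norm_exp_ofReal_mul_I, one_mul,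
    Complex.norm_exp_I_mul_ofReal_sub_one, norm_mul, Real.norm_eq_abs, Real.norm_eq_abs]
  have habs : |Real.sin ((x - y) / 2)| = |Real.sin (|x - y| / 2)| := by
    rcases abs_choice (x - y) with h | h <;> rw [h]
    rw [neg_div, Real.sin_neg, abs_neg]
  have hs := Real.mul_le_sin (x := |x - y| / 2) (by positivity) (by linarith)
  rw [habs, abs_of_pos (two_pos (α := ℝ))]
  have := le_abs_self (Real.sin (|x - y| / 2))
  linarith

/-! ### Choice of the projection direction -/

/-- For unit vectors, take the signed sum `w` of largest norm. Flipping one sign cannot lengthen it,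
which forces `|⟪w, z i⟫| ≥ 1`, while `‖w‖` is at most the number of vectors. -/
theorem exists_norm_eq_one_forall_norm_le_card_mul_abs_inner {E ι : Type*} [NormedAddCommGroup E]
    [InnerProductSpace ℝ E] [Fintype ι] [Nonempty ι] {z : ι → E} (hz : ∀ i, z i ≠ 0) :
    ∃ u : E, ‖u‖ = 1 ∧ ∀ i, ‖z i‖ ≤ Fintype.card ι * |inner ℝ u (z i)| := by
  classical
  wlog hz1 : ∀ i, ‖z i‖ = 1 generalizing z
  · obtain ⟨u, hu, h⟩ := this (z := fun i => (‖z i‖⁻¹ : ℝ) • z i)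
      (fun i => smul_ne_zero (inv_ne_zero (norm_ne_zero_iff.2 (hz i))) (hz i))
      (fun i => norm_smul_inv_norm (𝕜 := ℝ) (hz i))
    refine ⟨u, hu, fun i => ?_⟩
    have hi := h i
    have hpos := norm_pos_iff.2 (hz i)
    rw [norm_smul, inner_smul_right, abs_mul, norm_inv, norm_norm, abs_inv, abs_norm,
      inv_mul_cancel₀ hpos.ne'] at hi
    calc ‖z i‖ = ‖z i‖ * 1 := (mul_one _).symm
      _ ≤ ‖z i‖ * (Fintype.card ι * (‖z i‖⁻¹ * |inner ℝ u (z i)|)) := by gcongr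
      _ = _ := by field_simp
  let s : Bool → ℝ := fun b => if b then 1 else -1
  have hs : ∀ b, |s b| = 1 := by intro b; cases b <;> simp [s]
  have hs' : ∀ b, s (!b) = -s b := by intro b; cases b <;> simp [s]
  obtain ⟨ε, hε⟩ := Finite.exists_max fun ε : ι → Bool => ‖∑ i, s (ε i) • z i‖
  set w := ∑ i, s (ε i) • z i with hw
  have hflip : ∀ i, ∑ k, s (Function.update ε i (!ε i) k) • z k = w - (2 * s (ε i)) • z i := by
    intro i
    rw [eq_sub_iff_add_eq, hw, ← Finset.add_sum_erase _ _ (Finset.mem_univ i),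
      ← Finset.add_sum_erase _ (fun k => s (ε k) • z k) (Finset.mem_univ i),
      Finset.sum_congr rfl fun k hk => by rw [Function.update_of_ne (Finset.ne_of_mem_erase hk)],
      Function.update_self, hs']
    module
  have hin : ∀ i, 1 ≤ |inner ℝ w (z i)| := by
    intro i
    have h1 := hε (Function.update ε i (!ε i))
    simp only [hflip] at h1
    have h2 := pow_le_pow_left₀ (norm_nonneg _) h1 2
    rw [norm_sub_sq_real, norm_smul, hz1, inner_smul_right, Real.norm_eq_abs, abs_mul, hs] at h2
    norm_num at h2
    have h3 : s (ε i) * inner ℝ w (z i) ≤ |inner ℝ w (z i)| := by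
      refine (le_abs_self _).trans_eq ?_
      rw [abs_mul, hs, one_mul]
    linarith
  have hwc : ‖w‖ ≤ Fintype.card ι := by
    refine (norm_sum_le _ _).trans_eq ?_
    simp [norm_smul, hs, hz1]
  have hw0 : w ≠ 0 := by
    intro h
    have := hin (Classical.arbitrary ι)
    rw [h, inner_zero_left, abs_zero] at this
    linarith
  have hwpos := norm_pos_iff.2 hw0
  refine ⟨(‖w‖⁻¹ : ℝ) • w, norm_smul_inv_norm (𝕜 := ℝ) hw0, fun i => ?_⟩
  rw [hz1, real_inner_smul_left, abs_mul, abs_inv, abs_norm, ← mul_assoc, ← div_eq_mul_inv]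
  have h1 : 1 ≤ (Fintype.card ι : ℝ) / ‖w‖ := (one_le_div hwpos).2 hwc
  nlinarith [hin i]

theorem exists_norm_eq_one_forall_norm_sub_le_mul_abs_inner {E : Type*} [NormedAddCommGroup E]
    [InnerProductSpace ℝ E] {n : ℕ} (hn : 2 ≤ n) {y : Fin n → E} (hy : Function.Injective y) :
    ∃ u : E, ‖u‖ = 1 ∧ ∀ p j, ‖y p - y j‖ ≤ (n : ℝ) * (n - 1) / 2 * |inner ℝ u (y p - y j)| := by
  let ι := Σ j : Fin n, Fin j
  have hcard : (Fintype.card ι : ℝ) = (n : ℝ) * (n - 1) / 2 := by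
    have h : Fintype.card ι * 2 = n * (n - 1) := by
      rw [Fintype.card_sigma, ← Finset.sum_range_id_mul_two]
      simp [Fin.sum_univ_eq_sum_range (fun i => i)]
    have h' : ((Fintype.card ι * 2 : ℕ) : ℝ) = ((n * (n - 1) : ℕ) : ℝ) := by rw [h]
    rw [Nat.cast_mul, Nat.cast_mul, Nat.cast_sub (by omega)] at h'
    push_cast at h'
    linarith
  have : Nonempty ι := ⟨⟨⟨1, hn⟩, ⟨0, by simp⟩⟩⟩
  obtain ⟨u, hu, h⟩ := exists_norm_eq_one_forall_norm_le_card_mul_abs_inner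
    (z := fun i : ι => y i.1 - y ⟨i.2, i.2.2.trans i.1.2⟩)
    (fun i => sub_ne_zero.2 (hy.ne (Fin.ne_of_gt i.2.2)))
  rw [hcard] at h
  refine ⟨u, hu, fun p j => ?_⟩
  rcases lt_trichotomy p j with hlt | rfl | hlt
  · have := h ⟨j, ⟨p, hlt⟩⟩
    rwa [norm_sub_rev, ← neg_sub (y j), inner_neg_right, abs_neg]
  · simp
  · exact h ⟨p, ⟨j, hlt⟩⟩

theorem exists_norm_eq_one_forall_norm_eq_abs_inner {E : Type*} [NormedAddCommGroup E]
    [InnerProductSpace ℝ E] [FiniteDimensional ℝ E] {V : Submodule ℝ E}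
    (hV : Module.finrank ℝ V ≤ 1) (hV0 : V ≠ ⊥) :
    ∃ u : E, ‖u‖ = 1 ∧ ∀ x ∈ V, ‖x‖ = |inner ℝ u x| := by
  obtain ⟨v, hv⟩ := finrank_le_one_iff.1 hV
  have hv0 : (v : E) ≠ 0 := by
    intro h
    refine hV0 ((Submodule.eq_bot_iff V).2 fun x hx => ?_)
    obtain ⟨c, hc⟩ := hv ⟨x, hx⟩
    have := congrArg Subtype.val hc
    simpa [h] using this.symm
  have hpos := norm_pos_iff.2 hv0
  refine ⟨(‖(v : E)‖⁻¹ : ℝ) • (v : E), norm_smul_inv_norm (𝕜 := ℝ) hv0, fun x hx => ?_⟩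
  obtain ⟨c, hc⟩ := hv ⟨x, hx⟩
  have hx' : x = c • (v : E) := (congrArg Subtype.val hc).symm
  rw [hx', real_inner_smul_left, real_inner_smul_right, real_inner_self_eq_norm_sq, norm_smul,
    Real.norm_eq_abs, abs_mul, abs_mul, abs_inv, abs_norm, abs_pow, abs_norm]
  field_simp

/-! ### The one-dimensional case -/

theorem not_forall_norm_fourier_sub_le {N m : ℕ} (hN : 1 ≤ N) (hm : m ≤ N) {Ω σ A : ℝ}
    (hΩ : 0 < Ω) (hσ : 0 < σ) (hA : 0 < A) {b : Fin (N + 1) → ℂ} {t : Fin (N + 1) → ℝ}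
    (c : Fin m → ℂ) (t' : Fin m → ℝ) (hb : ∀ j, A ≤ ‖b j‖)
    (ht : ∀ j, |t j| ≤ N * Real.pi / (2 * Ω))
    (hsep : ∀ p j, p ≠ j →
      4.4 * Real.pi * Real.exp 1 / Ω * (σ / A) ^ (1 / (2 * (N : ℝ))) ≤ |t p - t j|) :
    ¬ ∀ x : ℝ, |x| ≤ Ω → ‖∑ j, b j * Complex.exp (Complex.I * ((t j * x : ℝ) : ℂ))
      - ∑ j, c j * Complex.exp (Complex.I * ((t' j * x : ℝ) : ℂ))‖ ≤ 2 * σ := by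
  intro hF
  have hπ := Real.pi_pos
  have hNpos : (0 : ℝ) < N := by exact_mod_cast hN
  set ρ := (σ / A) ^ (1 / (2 * (N : ℝ))) with hρ
  have hρpos : 0 < ρ := Real.rpow_pos_of_pos (div_pos hσ hA) _
  have hρpow : (ρ ^ N) ^ 2 = σ / A := by
    rw [← pow_mul, hρ, ← Real.rpow_natCast, ← Real.rpow_mul (div_pos hσ hA).le]
    rw [show 1 / (2 * (N : ℝ)) * ((N * 2 : ℕ) : ℝ) = 1 by push_cast; field_simp, Real.rpow_one]
  -- With this step the samples `-Ω + l h`, `l ≤ 2N`, fill `[-Ω, Ω]`, and the phases `t j * h` lie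
  -- within `π / 2` of 0, so the chord bound applies.
  set h := Ω / N with hh
  have hhpos : 0 < h := div_pos hΩ hNpos
  let e : ℝ → ℂ := fun x => Complex.exp (Complex.I * (x : ℂ))
  have he : ∀ x, ‖e x‖ = 1 := fun x => by
    simp only [e]; rw [mul_comm, Complex.norm_exp_ofReal_mul_I]
  have hsplit : ∀ (x : ℝ) (l : ℕ), e (x * (-Ω + l * h)) = e (-(x * Ω)) * e (x * h) ^ l := by
    intro x l
    simp only [e]
    rw [← Complex.exp_nat_mul, ← Complex.exp_add]
    push_cast
    ring_nf
  have hth : ∀ j, |t j * h| ≤ Real.pi / 2 := fun j => by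
    rw [abs_mul, abs_of_pos hhpos]
    calc _ ≤ N * Real.pi / (2 * Ω) * h := by gcongr; exact ht j
      _ = _ := by rw [hh]; field_simp
  have hchord : ∀ p j, |2 / Real.pi * (t p * h) - 2 / Real.pi * (t j * h)|
      ≤ ‖e (t p * h) - e (t j * h)‖ := by
    intro p j
    rw [← mul_sub, abs_mul, abs_of_pos (by positivity : 0 < 2 / Real.pi)]
    refine two_div_pi_mul_abs_sub_le_norm_exp_sub_exp ?_
    have := abs_sub (t p * h) (t j * h)
    linarith [hth p, hth j]
  set δ := 8.8 * Real.exp 1 * ρ / N with hδ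
  have hδpos : 0 < δ := by positivity
  have hsep' : ∀ p j, p ≠ j → δ ≤ |2 / Real.pi * (t p * h) - 2 / Real.pi * (t j * h)| := by
    intro p j hpj
    rw [← mul_sub, ← sub_mul, abs_mul, abs_mul, abs_of_pos hhpos,
      abs_of_pos (by positivity : 0 < 2 / Real.pi)]
    calc δ = 2 / Real.pi * (4.4 * Real.pi * Real.exp 1 / Ω * ρ * h) := by
          rw [hδ, hh]; field_simp; norm_num
      _ ≤ _ := by gcongr; exact hsep p j hpj
  have hinj : Function.Injective fun j => e (t j * h) := by
    intro p j hpj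
    by_contra hne
    have h1 := (hsep' p j hne).trans (hchord p j)
    simp only at hpj
    rw [hpj, sub_self, norm_zero] at h1
    linarith
  have hmain := le_sum_inv_sq_of_norm_moments_le hm (z := fun j => e (t j * h)) hinj
    (fun j => (he _).le) (w := fun j => e (t' j * h)) (fun j => (he _).le)
    (b := fun j => b j * e (-(t j * Ω))) (c := fun j => c j * e (-(t' j * Ω))) (A := A)
    (M := 2 * σ) (fun j => by rw [norm_mul, he, mul_one]; exact hb j) (by
      intro l hl
      have hl' : (l : ℝ) ≤ 2 * N := by exact_mod_cast hl
      have hx : |-Ω + l * h| ≤ Ω := by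
        have h1 : 0 ≤ l * h := by positivity
        have h2 : l * h ≤ 2 * Ω := by
          calc _ ≤ 2 * N * h := by gcongr
            _ = _ := by rw [hh]; field_simp
        rw [abs_le]; constructor <;> linarith
      have := hF _ hx
      simpa only [← hsplit, mul_assoc] using this)
  have hsum : ∑ j, ((∏ p ∈ Finset.univ.erase j, ‖e (t j * h) - e (t p * h)‖) ^ 2)⁻¹
      ≤ 4 ^ N / ((Nat.factorial N : ℝ) * δ ^ N) ^ 2 := by
    refine le_trans ?_ (sum_inv_sq_prod_abs_sub_le hδpos hsep')
    refine Finset.sum_le_sum fun j _ => ?_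
    have hpos : 0 < ∏ p ∈ Finset.univ.erase j,
        |2 / Real.pi * (t j * h) - 2 / Real.pi * (t p * h)| :=
      Finset.prod_pos fun p hp => hδpos.trans_le (hsep' _ _ (Finset.ne_of_mem_erase hp).symm)
    gcongr
    exact hchord _ _
  -- `N! ≥ (N / e) ^ N` absorbs the factor `e` of the separation.
  have hfac : (8.8 * ρ) ^ N ≤ (Nat.factorial N : ℝ) * δ ^ N := by
    have h1 := Real.pow_div_factorial_le_exp _ hNpos.le N
    rw [div_le_iff₀ (by positivity)] at h1
    have h2 : Real.exp N = Real.exp 1 ^ N := by rw [← Real.exp_nat_mul, mul_one]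
    rw [h2] at h1
    calc (8.8 * ρ) ^ N = (N : ℝ) ^ N * (8.8 * ρ / N) ^ N := by
          rw [← mul_pow]; congr 1; field_simp
      _ ≤ Real.exp 1 ^ N * (Nat.factorial N : ℝ) * (8.8 * ρ / N) ^ N := by gcongr
      _ = (Nat.factorial N : ℝ) * (Real.exp 1 ^ N * (8.8 * ρ / N) ^ N) := by ring
      _ = _ := by rw [← mul_pow, hδ]; congr 2; ring
  have hfin : A ≤ 4 ^ N * (2 * σ) * (4 ^ N / ((8.8 * ρ) ^ N) ^ 2) := by
    refine hmain.trans ?_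
    gcongr
    refine hsum.trans ?_
    gcongr
  have hval : 4 ^ N * (2 * σ) * (4 ^ N / ((8.8 * ρ) ^ N) ^ 2) = 2 * A * (16 / 8.8 ^ 2) ^ N := by
    rw [mul_pow, mul_pow, hρpow, div_pow, ← pow_mul 8.8 2 N, ← pow_mul 8.8 N 2, mul_comm 2 N,
      show (16 : ℝ) = 4 * 4 by norm_num, mul_pow]
    field_simp
  -- The contradiction is `2 * 16 / 8.8 ^ 2 < 1`.
  have hlt : ((16 : ℝ) / 8.8 ^ 2) ^ N ≤ 16 / 8.8 ^ 2 := by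
    simpa using pow_le_pow_of_le_one (by norm_num) (by norm_num : (16 : ℝ) / 8.8 ^ 2 ≤ 1) hN
  rw [hval] at hfin
  have : 2 * A * (16 / 8.8 ^ 2 : ℝ) ^ N ≤ 2 * A * (16 / 8.8 ^ 2) := by gcongr
  norm_num at this hfin
  linarith

/-! ### Dimensional factor and conclusion -/

theorem spanDim_le {k n : ℕ} (y : Fin n → EuclideanSpace ℝ (Fin k)) : spanDim y ≤ n := by
  simpa [spanDim, Set.finrank] using finrank_range_le_card (R := ℝ) y

theorem half_mul_sub_one_le_pow_mul_rpow_xiSum {n s : ℕ} (hn : 2 ≤ n) (hs : 2 ≤ s) (hsn : s ≤ n) :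
    (n : ℝ) * (n - 1) / 2
      ≤ (Real.pi / 2) ^ (s - 1) * ((n : ℝ) * (n - 1) / Real.pi) ^ xiSum (s - 1) := by
  have hπ := Real.pi_pos
  rcases hn.eq_or_lt with rfl | hn3
  -- Here the base `2 / π` is below 1, but the exponent is exactly 1 and equality holds.
  · obtain rfl : s = 2 := by omega
    norm_num [xiSum]
  · have hn' : (3 : ℝ) ≤ n := by exact_mod_cast hn3
    have h1 : 1 ≤ (n : ℝ) * (n - 1) / Real.pi := by
      rw [one_le_div hπ]
      nlinarith [Real.pi_lt_four]
    have h2 : 1 ≤ xiSum (s - 1) := by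
      have := Finset.single_le_sum (f := fun j : ℕ => 1 / (j : ℝ)) (s := Finset.Icc 1 (s - 1))
        (fun i _ => by positivity) (Finset.mem_Icc.2 ⟨le_refl 1, by omega⟩)
      simpa [xiSum] using this
    have h3 : 1 ≤ Real.pi / 2 := by linarith [Real.two_le_pi]
    calc (n : ℝ) * (n - 1) / 2 = (Real.pi / 2) ^ 1 * ((n : ℝ) * (n - 1) / Real.pi) ^ (1 : ℝ) := by
          rw [Real.rpow_one]; field_simp
      _ ≤ _ := by
          gcongr
          omega

theorem theorem2p1 (k n : ℕ) (hn : 2 ≤ n) (Ω σ : ℝ) (hΩ : 0 < Ω)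
    (a : Fin n → ℂ) (ha : ∀ j, a j ≠ 0)
    (y : Fin n → EuclideanSpace ℝ (Fin k))
    (hy : ∀ j, ‖y j‖ ≤ ((n : ℝ) - 1) * Real.pi / (2 * Ω))
    (Y W : EuclideanSpace ℝ (Fin k) → ℂ)
    (hY : ∀ ω, ‖ω‖ ≤ Ω → Y ω = discreteFourier a y ω + W ω)
    (hW : ∀ ω, ‖ω‖ ≤ Ω → ‖W ω‖ < σ)
    (hsep : ∀ p j : Fin n, p ≠ j →
      4.4 * Real.pi * Real.exp 1 * (Real.pi / 2) ^ (spanDim y - 1) *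
          ((n : ℝ) * ((n : ℝ) - 1) / Real.pi) ^ (xiSum (spanDim y - 1)) / Ω *
          (σ / minAmplitude a) ^ (1 / (2 * (n : ℝ) - 2))
        ≤ ‖y p - y j‖) :
    ¬ ∃ m : ℕ, m < n ∧ ∃ (a' : Fin m → ℂ) (y' : Fin m → EuclideanSpace ℝ (Fin k)),
      IsSigmaAdmissible Ω σ Y a' y' := by
  rintro ⟨m, hmn, a', y', hadm⟩
  have hπ := Real.pi_pos
  have hσ : 0 < σ := (norm_nonneg _).trans_lt (hW 0 (by simpa using hΩ.le))
  have : Nonempty (Fin n) := ⟨⟨0, by omega⟩⟩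
  have hA : 0 < minAmplitude a := by
    obtain ⟨j, hj⟩ := exists_eq_ciInf_of_finite (f := fun j => ‖a j‖)
    rw [minAmplitude, ← hj]
    exact norm_pos_iff.2 (ha j)
  have hAle : ∀ j, minAmplitude a ≤ ‖a j‖ := fun j => ciInf_le (Set.finite_range _).bddBelow j
  have hn1 : (0 : ℝ) < (n : ℝ) - 1 := by
    have : (2 : ℝ) ≤ n := by exact_mod_cast hn
    linarith
  have hnpos : (0 : ℝ) < n := by linarith
  set F := (Real.pi / 2) ^ (spanDim y - 1) *
    ((n : ℝ) * ((n : ℝ) - 1) / Real.pi) ^ (xiSum (spanDim y - 1)) with hF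
  have hFpos : 0 < F := mul_pos (by positivity) (Real.rpow_pos_of_pos (by positivity) _)
  set ρ := (σ / minAmplitude a) ^ (1 / (2 * (n : ℝ) - 2)) with hρ
  have hρpos : 0 < ρ := Real.rpow_pos_of_pos (div_pos hσ hA) _
  have hsep' : ∀ p j, p ≠ j → F * (4.4 * Real.pi * Real.exp 1 / Ω * ρ) ≤ ‖y p - y j‖ := by
    intro p j hpj
    refine le_trans (le_of_eq ?_) (hsep p j hpj)
    rw [hF]; ring
  have hinj : Function.Injective y := by
    intro p j hpj
    by_contra hne
    have h1 := hsep' p j hne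
    rw [hpj, sub_self, norm_zero] at h1
    have : 0 < F * (4.4 * Real.pi * Real.exp 1 / Ω * ρ) := by positivity
    linarith
  obtain ⟨u, hu, hproj⟩ : ∃ u : EuclideanSpace ℝ (Fin k), ‖u‖ = 1 ∧
      ∀ p j, ‖y p - y j‖ ≤ F * |inner ℝ u (y p - y j)| := by
    -- In dimension at most 1 the factor `F` is 1 and projecting onto the line loses nothing.
    rcases le_or_gt (spanDim y) 1 with hs | hs
    · have hmem : ∀ j, y j ∈ Submodule.span ℝ (Set.range y) := fun j =>
        Submodule.subset_span ⟨j, rfl⟩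
      obtain ⟨u, hu, h⟩ := exists_norm_eq_one_forall_norm_eq_abs_inner hs (by
        intro hbot
        have h0 : ∀ j, y j = 0 := fun j => by
          have := hmem j
          rwa [hbot, Submodule.mem_bot] at this
        have := hinj ((h0 ⟨0, by omega⟩).trans (h0 ⟨1, by omega⟩).symm)
        simp at this)
      refine ⟨u, hu, fun p j => ?_⟩
      rw [hF, Nat.sub_eq_zero_of_le hs, h _ (Submodule.sub_mem _ (hmem p) (hmem j))]
      simp [xiSum]
    · obtain ⟨u, hu, h⟩ := exists_norm_eq_one_forall_norm_sub_le_mul_abs_inner hn hinj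
      refine ⟨u, hu, fun p j => (h p j).trans ?_⟩
      gcongr
      exact half_mul_sub_one_le_pow_mul_rpow_xiSum hn hs (spanDim_le y)
  obtain ⟨N, rfl⟩ : ∃ N, n = N + 1 := ⟨n - 1, by omega⟩
  have hN : ((N + 1 : ℕ) : ℝ) - 1 = N := by push_cast; ring
  refine not_forall_norm_fourier_sub_le (N := N) (by omega) (Nat.lt_succ_iff.1 hmn) hΩ hσ hA
    (b := a) (t := fun j => inner ℝ (y j) u) a' (fun j => inner ℝ (y' j) u) hAle ?_ ?_ ?_
  · intro j
    rw [← hN]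
    refine (abs_real_inner_le_norm _ _).trans ?_
    rw [hu, mul_one]
    exact hy j
  · intro p j hpj
    have h1 := (hsep' p j hpj).trans (hproj p j)
    rw [real_inner_comm, inner_sub_left] at h1
    rw [show 2 * (N : ℝ) = 2 * ((N + 1 : ℕ) : ℝ) - 2 by push_cast; ring]
    exact le_of_mul_le_mul_left h1 hFpos
  · intro x hx
    have hω : ‖x • u‖ ≤ Ω := by rwa [norm_smul, hu, mul_one]
    have h1 := hadm _ hω
    have h2 := hW _ hω
    rw [hY _ hω] at h1
    have h3 : ‖discreteFourier a y (x • u) - discreteFourier a' y' (x • u)‖ ≤ 2 * σ := by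
      calc _ = ‖(discreteFourier a' y' (x • u) - (discreteFourier a y (x • u) + W (x • u)))
              + W (x • u)‖ := by rw [norm_sub_rev]; congr 1; ring
        _ ≤ _ := (norm_add_le _ _).trans (by linarith)
    simpa only [discreteFourier, real_inner_smul_right, mul_comm x] using h3
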